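/- For an integer $n\ge 0$ let $L_n(x)=\sum_{k=0}^n\binom nk\frac{(-1)^k}{k!}x^k$ be the Laguerre polynomial, and for real $p\ge n$ let $$A(p)=A_n(p)=\frac{\Gamma(1+p)}{n!\,\Gamma(1+p-n)^2}\int_0^\infty \frac{e^{-r}r^{p-n}}{L_n(-r)}\,dr ,$$ where the integral converges. Then: 1. For every $n\ge 0$, $A(p)\to 1$ as $p\to\infty$ ($p$ real). 2. If $1\le n\le 4$, then $A(p)<1$ for all real $p\ge n$; if $n=0$, then $A(p)=1$ for all real $p\ge 0$. 3. Let $0\le n\le 4$ and $\alpha>0$, and put $d\mu_\alpha(z)=\frac{\alpha}{\pi}e^{-\alpha|z|^2}\,dA(z)$ on $\mathbb C$, where $dA$ is Lebesgue measure, and $d\mu_{n,\alpha}(z)=\frac{1}{n!\,\alpha^n L_n(-\alpha|z|^2)}\,d\mu_\alpha(z)$. If $f$ is an entire function with $\|f\|^2:=\int_{\mathbb C}|f|^2\,d\mu_\alpha<\infty$, then $f^{(n)}\in L^2(\mathbb C,\mu_{n,\alpha})$ and $$\int_{\mathbb C}|f^{(n)}|^2\,d\mu_{n,\alpha}\le\|f\|^2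 .$$ -/

import Mathlib

open MeasureTheory

noncomputable section

/-- The Laguerre polynomial `L_n(x) = ∑_{k=0}^n (n choose k) (-1)^k / k! * x^k`, as a real
function. -/
def laguerre (n : ℕ) (x : ℝ) : ℝ :=
  ∑ k ∈ Finset.range (n + 1), (n.choose k : ℝ) * ((-1) ^ k / (k.factorial : ℝ)) * x ^ k

/-- The integrand `e^{-r} r^{p-n} / L_n(-r)`. -/
def laguerreIntegrand (n : ℕ) (p r : ℝ) : ℝ :=
  Real.exp (-r) * r ^ (p - (n : ℝ)) / laguerre n (-r)

/-- `A(p) = Γ(1+p) / (n! Γ(1+p-n)^2) * ∫_0^∞ e^{-r} r^{p-n} / L_n(-r) dr`. -/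
def laguerreA (n : ℕ) (p : ℝ) : ℝ :=
  Real.Gamma (1 + p) / ((n.factorial : ℝ) * Real.Gamma (1 + p - (n : ℝ)) ^ 2) *
    ∫ r in Set.Ioi (0 : ℝ), laguerreIntegrand n p r

/-- The Gaussian measure `dμ_α = (α/π) e^{-α|z|²} dA` on the complex plane. -/
def fockMeasure (α : ℝ) : Measure ℂ :=
  (volume : Measure ℂ).withDensity fun z =>
    ENNReal.ofReal (α / Real.pi * Real.exp (-α * ‖z‖ ^ 2))

/-- The measure `dμ_{n,α} = 1 / (n! α^n L_n(-α|z|²)) dμ_α`. -/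
def fockMeasureN (n : ℕ) (α : ℝ) : Measure ℂ :=
  (fockMeasure α).withDensity fun z =>
    ENNReal.ofReal (1 / ((n.factorial : ℝ) * α ^ n * laguerre n (-α * ‖z‖ ^ 2)))

/-- Membership in the Fock space `F²_α`: entire functions in `L²(ℂ, μ_α)`. -/
def MemFock (α : ℝ) (f : ℂ → ℂ) : Prop :=
  Differentiable ℂ f ∧ MemLp f 2 (fockMeasure α)

end

/-! Up to a Gamma factor, `A_n(p)` is the expectation of `1 / L_n(-r)` under the Gamma law with
shape `s = p - n + 1`. Integration by parts gives `E_s[u] = E_{s+1}[u - u']`. After `n` such steps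
the weight `r ^ n` relating the laws of shapes `s` and `s + n` absorbs the Gamma factor, so that
`n! A_n(p) = E_s[r ^ n (1 - d/dr)^n (1 / L_n(-r))]`. For `n ≤ 4` this integrand is pointwise less
than `n!`, since clearing the denominator leaves a polynomial with nonnegative coefficients.

For the limit, `r ^ n / L_n(-r)` is bounded on `(0, ∞)` and tends to `n!`, while the Gamma laws of
shape `a → ∞` escape to infinity because `E_a[1 / r] = 1 / (a - 1)`.

By Parseval on circles, `‖f‖²` is the sum over the Taylor coefficients `c_m` of
`|c_m|² m! / α ^ m`, and the weighted norm of `f⁽ⁿ⁾` is the sum of the same terms with `m ≥ n`, each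
multiplied by `A_n(m)`. Hence `A_n ≤ 1` gives the norm inequality. -/

section GammaDistribution

open Filter Topology ProbabilityTheory

theorem gammaMeasure_eq_withDensity_restrict (a b : ℝ) :
    gammaMeasure a b = (volume.restrict (Set.Ioi 0)).withDensity (gammaPDF a b) := by
  rw [gammaMeasure, ← withDensity_indicator measurableSet_Ioi]
  refine withDensity_congr_ae ?_
  filter_upwards [compl_mem_ae_iff.2 (measure_singleton (0 : ℝ))] with r hr
  rcases lt_or_gt_of_ne (show r ≠ 0 from hr) with hneg | hpos
  · rw [gammaPDF_of_neg hneg, Set.indicator_of_notMem (by simpa using hneg.le)]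
  · rw [Set.indicator_of_mem (Set.mem_Ioi.2 hpos)]

theorem ae_pos_gammaMeasure (a b : ℝ) : ∀ᵐ r ∂gammaMeasure a b, 0 < r := by
  rw [gammaMeasure_eq_withDensity_restrict]
  exact (withDensity_absolutelyContinuous _ _).ae_le (ae_restrict_mem measurableSet_Ioi)

theorem measurable_gammaPDF (a b : ℝ) : Measurable (gammaPDF a b) :=
  (measurable_gammaPDFReal a b).ennreal_ofReal

theorem lintegral_gammaMeasure (a b : ℝ) {u : ℝ → ENNReal} (hu : Measurable u) :
    ∫⁻ r, u r ∂gammaMeasure a b = ∫⁻ r in Set.Ioi 0, gammaPDF a b r * u r := by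
  rw [gammaMeasure_eq_withDensity_restrict,
    lintegral_withDensity_eq_lintegral_mul _ (measurable_gammaPDF a b) hu]
  rfl

variable {a b : ℝ} {u : ℝ → ℝ}

theorem integrable_gammaMeasure_iff (ha : 0 < a) (hb : 0 < b) :
    Integrable u (gammaMeasure a b) ↔
      IntegrableOn (fun r => gammaPDFReal a b r * u r) (Set.Ioi 0) := by
  rw [gammaMeasure_eq_withDensity_restrict, integrable_withDensity_iff_integrable_smul'
    (measurable_gammaPDF a b) (by simp [gammaPDF])]
  simp only [gammaPDF, ENNReal.toReal_ofReal (gammaPDFReal_nonneg ha hb _), smul_eq_mul,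
    IntegrableOn]

theorem integral_gammaMeasure (ha : 0 < a) (hb : 0 < b) (u : ℝ → ℝ) :
    ∫ r, u r ∂gammaMeasure a b = ∫ r in Set.Ioi 0, gammaPDFReal a b r * u r := by
  rw [gammaMeasure_eq_withDensity_restrict, integral_withDensity_eq_integral_toReal_smul
    (measurable_gammaPDF a b) (by simp [gammaPDF])]
  simp only [gammaPDF, ENNReal.toReal_ofReal (gammaPDFReal_nonneg ha hb _), smul_eq_mul]

theorem gammaPDFReal_mul_pow (ha : 0 < a) (hb : 0 < b) (n : ℕ) {r : ℝ} (hr : 0 < r) :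
    gammaPDFReal a b r * r ^ n =
      Real.Gamma (a + n) / (Real.Gamma a * b ^ n) * gammaPDFReal (a + n) b r := by
  have : 0 < Real.Gamma (a + n) := Real.Gamma_pos_of_pos (by positivity)
  rw [gammaPDFReal, gammaPDFReal, if_pos hr.le, if_pos hr.le, add_sub_right_comm,
    Real.rpow_add_natCast hr.ne', Real.rpow_add_natCast hb.ne']
  field_simp

theorem integrable_pow_mul_gammaMeasure_iff (ha : 0 < a) (hb : 0 < b) (n : ℕ) :
    Integrable (fun r => r ^ n * u r) (gammaMeasure a b) ↔
      Integrable u (gammaMeasure (a + n) b) := by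
  have := Real.Gamma_pos_of_pos ha
  have : 0 < Real.Gamma (a + n) := Real.Gamma_pos_of_pos (by positivity)
  have hc : Real.Gamma (a + n) / (Real.Gamma a * b ^ n) ≠ 0 := by positivity
  rw [integrable_gammaMeasure_iff ha hb, integrable_gammaMeasure_iff (by positivity) hb,
    IntegrableOn, IntegrableOn,
    ← integrable_const_mul_iff (IsUnit.mk0 _ hc) (fun r => gammaPDFReal (a + n) b r * u r)]
  refine integrableOn_congr_fun (fun r hr => ?_) measurableSet_Ioi
  simp only [← mul_assoc, gammaPDFReal_mul_pow ha hb n (Set.mem_Ioi.1 hr)]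

theorem integral_pow_mul_gammaMeasure (ha : 0 < a) (hb : 0 < b) (n : ℕ) (u : ℝ → ℝ) :
    ∫ r, r ^ n * u r ∂gammaMeasure a b =
      Real.Gamma (a + n) / (Real.Gamma a * b ^ n) * ∫ r, u r ∂gammaMeasure (a + n) b := by
  rw [integral_gammaMeasure ha hb, integral_gammaMeasure (by positivity) hb,
    ← integral_const_mul]
  refine setIntegral_congr_fun measurableSet_Ioi fun r hr => ?_
  simp only [← mul_assoc, gammaPDFReal_mul_pow ha hb n (Set.mem_Ioi.1 hr)]

theorem integrable_pow_gammaMeasure (ha : 0 < a) (hb : 0 < b) (n : ℕ) :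
    Integrable (fun r => r ^ n) (gammaMeasure a b) := by
  have := isProbabilityMeasure_gammaMeasure (a := a + n) (by positivity) hb
  simpa only [mul_one] using
    (integrable_pow_mul_gammaMeasure_iff ha hb n).2 (integrable_const (1 : ℝ))

theorem integrable_eval_gammaMeasure (ha : 0 < a) (hb : 0 < b) (P : Polynomial ℝ) :
    Integrable (fun r => P.eval r) (gammaMeasure a b) := by
  simp only [Polynomial.eval_eq_sum_range]
  exact integrable_finsetSum _ fun k _ => (integrable_pow_gammaMeasure ha hb k).const_mul _

theorem integrable_inv_gammaMeasure (ha : 1 < a) (hb : 0 < b) :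
    Integrable (fun r => r⁻¹) (gammaMeasure a b) := by
  have ha' : 0 < a - 1 := sub_pos.2 ha
  have := isProbabilityMeasure_gammaMeasure ha' hb
  have hone : Integrable (fun r : ℝ => r ^ 1 * r⁻¹) (gammaMeasure (a - 1) b) := by
    refine (integrable_const (1 : ℝ)).congr ?_
    filter_upwards [ae_pos_gammaMeasure (a - 1) b] with r hr
    rw [pow_one, mul_inv_cancel₀ hr.ne']
  simpa using (integrable_pow_mul_gammaMeasure_iff ha' hb 1).1 hone

theorem integral_inv_gammaMeasure (ha : 1 < a) (hb : 0 < b) :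
    ∫ r, r⁻¹ ∂gammaMeasure a b = b / (a - 1) := by
  have ha' : 0 < a - 1 := sub_pos.2 ha
  have := isProbabilityMeasure_gammaMeasure ha' hb
  have hone : ∫ r, r ^ 1 * r⁻¹ ∂gammaMeasure (a - 1) b = 1 := by
    rw [integral_congr_ae (g := fun _ => 1)]
    · simp
    · filter_upwards [ae_pos_gammaMeasure (a - 1) b] with r hr
      rw [pow_one, mul_inv_cancel₀ hr.ne']
  have hΓ := Real.Gamma_pos_of_pos ha'
  rw [integral_pow_mul_gammaMeasure ha' hb, Nat.cast_one, Real.Gamma_add_one ha'.ne',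
    sub_add_cancel] at hone
  field_simp at hone ⊢
  linarith

theorem exists_abs_sub_le_add_mul_inv {c M : ℝ} (hM : ∀ r, 0 < r → |u r| ≤ M)
    (hu : Tendsto u atTop (𝓝 c)) {ε : ℝ} (hε : 0 < ε) :
    ∃ K, ∀ r, 0 < r → |u r - c| ≤ ε + K * r⁻¹ := by
  obtain ⟨R, hR⟩ := eventually_atTop.1 (Metric.tendsto_nhds.1 hu ε hε)
  have hM0 : 0 ≤ M + |c| := add_nonneg ((abs_nonneg _).trans (hM 1 one_pos)) (abs_nonneg c)
  refine ⟨(M + |c|) * |R|, fun r hr => ?_⟩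
  rcases le_total R r with hRr | hrR
  · have := hR r hRr
    rw [Real.dist_eq] at this
    have : 0 ≤ (M + |c|) * |R| * r⁻¹ := by positivity
    linarith
  · calc |u r - c| ≤ |u r| + |c| := abs_sub _ _
      _ ≤ (M + |c|) * 1 := by linarith [hM r hr]
      _ ≤ (M + |c|) * (|R| * r⁻¹) := by
        gcongr
        rw [← div_eq_mul_inv, one_le_div hr]
        exact hrR.trans (le_abs_self R)
      _ ≤ ε + (M + |c|) * |R| * r⁻¹ := by rw [mul_assoc]; linarith

theorem tendsto_integral_gammaMeasure {c M : ℝ} (hb : 0 < b) (hum : Measurable u)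
    (hM : ∀ r, 0 < r → |u r| ≤ M) (hu : Tendsto u atTop (𝓝 c)) :
    Tendsto (fun a => ∫ r, u r ∂gammaMeasure a b) atTop (𝓝 c) := by
  refine Metric.tendsto_nhds.2 fun ε hε => ?_
  obtain ⟨K, hK⟩ := exists_abs_sub_le_add_mul_inv hM hu (half_pos hε)
  have hlim : Tendsto (fun a : ℝ => ε / 2 + K * (b / (a - 1))) atTop (𝓝 (ε / 2)) := by
    simpa [sub_eq_add_neg] using ((tendsto_const_nhds (x := b)).div_atTop
      (tendsto_atTop_add_const_right _ (-1) tendsto_id)).const_mul K |>.const_add (ε / 2)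
  filter_upwards [hlim.eventually_lt_const (half_lt_self hε), eventually_gt_atTop 1]
    with a hlt ha
  have := isProbabilityMeasure_gammaMeasure (one_pos.trans ha) hb
  have hinv := (integrable_inv_gammaMeasure ha hb).const_mul K
  have hui : Integrable u (gammaMeasure a b) :=
    .of_bound hum.aestronglyMeasurable M ((ae_pos_gammaMeasure a b).mono hM)
  calc dist (∫ r, u r ∂gammaMeasure a b) c
      = |∫ r, (u r - c) ∂gammaMeasure a b| := by
        rw [integral_sub hui (integrable_const c), Real.dist_eq]; simp
    _ ≤ ∫ r, |u r - c| ∂gammaMeasure a b := abs_integral_le_integral_abs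
    _ ≤ ∫ r, (ε / 2 + K * r⁻¹) ∂gammaMeasure a b :=
        integral_mono_ae (hui.sub (integrable_const c)).abs ((integrable_const _).add hinv)
          ((ae_pos_gammaMeasure a b).mono hK)
    _ = ε / 2 + K * (b / (a - 1)) := by
        rw [integral_add (integrable_const _) hinv, integral_const_mul,
          integral_inv_gammaMeasure ha hb]
        simp
    _ < ε := hlt

theorem hasDerivAt_gammaPDFReal_add_one (ha : 0 < a) (hb : 0 < b) {r : ℝ} (hr : 0 < r) :
    HasDerivAt (gammaPDFReal (a + 1) b)
      (b * (gammaPDFReal a b r - gammaPDFReal (a + 1) b r)) r := by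
  have := Real.Gamma_pos_of_pos ha
  have hexp : HasDerivAt (fun x => Real.exp (-(b * x))) (Real.exp (-(b * r)) * -(b * 1)) r :=
    ((hasDerivAt_id r).const_mul b).neg.exp
  have hpow : HasDerivAt (fun x : ℝ => x ^ a) (a * r ^ (a - 1)) r :=
    Real.hasDerivAt_rpow_const (Or.inl hr.ne')
  have heq : gammaPDFReal (a + 1) b =ᶠ[𝓝 r]
      fun x => b ^ (a + 1) / Real.Gamma (a + 1) * x ^ a * Real.exp (-(b * x)) := by
    filter_upwards [eventually_gt_nhds hr] with x hx
    rw [gammaPDFReal, if_pos hx.le, add_sub_cancel_right]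
  refine (((hpow.const_mul _).mul hexp).congr_of_eventuallyEq heq).congr_deriv ?_
  rw [gammaPDFReal, gammaPDFReal, if_pos hr.le, if_pos hr.le, add_sub_cancel_right,
    Real.Gamma_add_one ha.ne', Real.rpow_add_one hb.ne']
  field_simp
  ring

theorem gammaPDFReal_add_one_zero (ha : 0 < a) (b : ℝ) : gammaPDFReal (a + 1) b 0 = 0 := by
  simp [gammaPDFReal, Real.zero_rpow ha.ne']

theorem continuousOn_gammaPDFReal_add_one (ha : 0 ≤ a) (b : ℝ) :
    ContinuousOn (gammaPDFReal (a + 1) b) (Set.Ici 0) := by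
  have hcont : Continuous fun x : ℝ =>
      b ^ (a + 1) / Real.Gamma (a + 1) * x ^ a * Real.exp (-(b * x)) := by
    have := Real.continuous_rpow_const ha
    fun_prop
  refine hcont.continuousOn.congr fun x hx => ?_
  rw [gammaPDFReal, if_pos (Set.mem_Ici.1 hx), add_sub_cancel_right]

/-- Integration by parts, since the densities satisfy `γ_{a+1}' = b (γ_a - γ_{a+1})`. -/
theorem integral_gammaMeasure_eq_integral_sub_deriv {u' : ℝ → ℝ} (ha : 0 < a) (hb : 0 < b)
    (hcont : ContinuousWithinAt u (Set.Ici 0) 0) (hderiv : ∀ r, 0 < r → HasDerivAt u (u' r) r)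
    (hu : Integrable u (gammaMeasure a b)) (hu₁ : Integrable u (gammaMeasure (a + 1) b))
    (hu' : Integrable u' (gammaMeasure (a + 1) b)) :
    ∫ r, u r ∂gammaMeasure a b = ∫ r, (u r - u' r / b) ∂gammaMeasure (a + 1) b := by
  have ha₁ : 0 < a + 1 := by linarith
  have hv : Integrable (fun r => u r - u' r / b) (gammaMeasure (a + 1) b) :=
    hu₁.sub (hu'.div_const b)
  rw [integrable_gammaMeasure_iff ha hb] at hu
  rw [integrable_gammaMeasure_iff ha₁ hb] at hu₁ hv
  have hprod : ∀ r ∈ Set.Ioi (0 : ℝ), HasDerivAt (fun r => gammaPDFReal (a + 1) b r * u r)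
      (b * (gammaPDFReal a b r * u r - gammaPDFReal (a + 1) b r * (u r - u' r / b))) r := by
    intro r hr
    refine ((hasDerivAt_gammaPDFReal_add_one ha hb hr).mul (hderiv r hr)).congr_deriv ?_
    field_simp
    ring
  have hint := (hu.sub hv).const_mul b
  have hparts := integral_Ioi_of_hasDerivAt_of_tendsto
    ((continuousOn_gammaPDFReal_add_one ha.le b 0 Set.self_mem_Ici).mul hcont) hprod hint
    (tendsto_zero_of_hasDerivAt_of_integrableOn_Ioi hprod hint hu₁)
  rw [Pi.mul_apply, gammaPDFReal_add_one_zero ha, zero_mul, sub_zero,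
    integral_const_mul, integral_sub hu hv, mul_eq_zero_iff_left hb.ne', sub_eq_zero] at hparts
  rw [integral_gammaMeasure ha hb, integral_gammaMeasure ha₁ hb, hparts]

end GammaDistribution

section RationalFunctions

open Polynomial ProbabilityTheory

/-- The numerator of `(1 - d/dr)^k (1 / L)` over the common denominator `L ^ (k + 1)`. -/
noncomputable def oneSubDerivNumerator (L : ℝ[X]) : ℕ → ℝ[X]
  | 0 => 1
  | k + 1 => (oneSubDerivNumerator L k - derivative (oneSubDerivNumerator L k)) * L +
      ((k + 1 : ℕ) : ℝ[X]) * oneSubDerivNumerator L k * derivative L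

theorem hasDerivAt_eval_div_eval_pow (P : ℝ[X]) {L : ℝ[X]} (m : ℕ) {r : ℝ} (hL : L.eval r ≠ 0) :
    HasDerivAt (fun r => P.eval r / L.eval r ^ m)
      ((derivative P * L - (m : ℝ[X]) * P * derivative L).eval r / L.eval r ^ (m + 1)) r := by
  refine ((P.hasDerivAt r).fun_div ((L.hasDerivAt r).fun_pow m) (pow_ne_zero m hL)).congr_deriv ?_
  rcases m with _ | m
  · simp [hL]
  · simp only [eval_sub, eval_mul, eval_natCast, Nat.add_sub_cancel]
    field_simp
    ring

variable {a b c : ℝ} {L : ℝ[X]}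

theorem integrable_eval_div_eval_pow_gammaMeasure (ha : 0 < a) (hb : 0 < b) (hc : 0 < c)
    (hL : ∀ r, 0 ≤ r → c ≤ L.eval r) (P : ℝ[X]) (m : ℕ) :
    Integrable (fun r => P.eval r / L.eval r ^ m) (gammaMeasure a b) := by
  refine ((integrable_eval_gammaMeasure ha hb P).div_const (c ^ m)).mono
    (P.continuous.measurable.div (L.continuous.measurable.pow_const m)).aestronglyMeasurable ?_
  filter_upwards [ae_pos_gammaMeasure a b] with r hr
  have hcL := hL r hr.le
  rw [norm_div, norm_div, norm_pow, norm_pow, Real.norm_of_nonneg hc.le,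
    Real.norm_of_nonneg (hc.le.trans hcL)]
  gcongr

theorem integral_eval_div_eval_pow_gammaMeasure (ha : 0 < a) (hc : 0 < c)
    (hL : ∀ r, 0 ≤ r → c ≤ L.eval r) (P : ℝ[X]) (m : ℕ) :
    ∫ r, P.eval r / L.eval r ^ m ∂gammaMeasure a 1 =
      ∫ r, ((P - derivative P) * L + (m : ℝ[X]) * P * derivative L).eval r / L.eval r ^ (m + 1)
        ∂gammaMeasure (a + 1) 1 := by
  have hL₀ (r : ℝ) (hr : 0 ≤ r) : L.eval r ≠ 0 := (hc.trans_le (hL r hr)).ne'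
  have ha₁ : 0 < a + 1 := by linarith
  rw [integral_gammaMeasure_eq_integral_sub_deriv ha one_pos
    (hasDerivAt_eval_div_eval_pow P m (hL₀ 0 le_rfl)).continuousAt.continuousWithinAt
    (fun r hr => hasDerivAt_eval_div_eval_pow P m (hL₀ r hr.le))
    (integrable_eval_div_eval_pow_gammaMeasure ha one_pos hc hL _ _)
    (integrable_eval_div_eval_pow_gammaMeasure ha₁ one_pos hc hL _ _)
    (integrable_eval_div_eval_pow_gammaMeasure ha₁ one_pos hc hL _ _)]
  refine integral_congr_ae ?_
  filter_upwards [ae_pos_gammaMeasure (a + 1) 1] with r hr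
  have := hL₀ r hr.le
  simp only [eval_add, eval_sub, eval_mul, eval_natCast, div_one]
  field_simp
  ring

theorem integral_inv_eval_gammaMeasure (ha : 0 < a) (hc : 0 < c)
    (hL : ∀ r, 0 ≤ r → c ≤ L.eval r) (k : ℕ) :
    ∫ r, (L.eval r)⁻¹ ∂gammaMeasure a 1 =
      ∫ r, (oneSubDerivNumerator L k).eval r / L.eval r ^ (k + 1) ∂gammaMeasure (a + k) 1 := by
  induction k with
  | zero => simp [oneSubDerivNumerator]
  | succ k ih =>
    rw [ih, integral_eval_div_eval_pow_gammaMeasure (by positivity) hc hL, oneSubDerivNumerator,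
      add_assoc a, ← Nat.cast_succ]

end RationalFunctions

section Laguerre

open Filter Topology Polynomial ProbabilityTheory

/-- The polynomial `L_n(-X)`, which has nonnegative coefficients. -/
noncomputable def laguerreNegPoly (n : ℕ) : ℝ[X] :=
  ∑ k ∈ Finset.range (n + 1), C (n.choose k / k.factorial : ℝ) * X ^ k

theorem eval_laguerreNegPoly (n : ℕ) (r : ℝ) : (laguerreNegPoly n).eval r = laguerre n (-r) := by
  simp only [laguerreNegPoly, laguerre, eval_finsetSum, eval_mul, eval_C, eval_pow, eval_X]
  refine Finset.sum_congr rfl fun k _ => ?_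
  have hsq : ((-1 : ℝ) ^ k) * (-1) ^ k = 1 := by rw [← mul_pow, neg_mul_neg, one_mul, one_pow]
  rw [neg_pow r]
  linear_combination -(n.choose k / k.factorial * r ^ k : ℝ) * hsq

theorem coeff_laguerreNegPoly (n k : ℕ) :
    (laguerreNegPoly n).coeff k = n.choose k / k.factorial := by
  simp only [laguerreNegPoly, finsetSum_coeff, coeff_C_mul_X_pow, Finset.sum_ite_eq,
    Finset.mem_range]
  split_ifs with h
  · rfl
  · rw [Nat.choose_eq_zero_of_lt (by omega), Nat.cast_zero, zero_div]

theorem coeff_mul_pow_le_eval_laguerreNegPoly (n : ℕ) {k : ℕ} (hk : k ≤ n) {r : ℝ} (hr : 0 ≤ r) :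
    n.choose k / k.factorial * r ^ k ≤ (laguerreNegPoly n).eval r := by
  simp only [laguerreNegPoly, eval_finsetSum, eval_mul, eval_C, eval_pow, eval_X]
  exact Finset.single_le_sum (f := fun k => (n.choose k / k.factorial : ℝ) * r ^ k)
    (fun k _ => by positivity) (Finset.mem_range_succ_iff.2 hk)

theorem one_le_eval_laguerreNegPoly (n : ℕ) (r : ℝ) (hr : 0 ≤ r) :
    1 ≤ (laguerreNegPoly n).eval r := by
  simpa using coeff_mul_pow_le_eval_laguerreNegPoly n n.zero_le hr

theorem pow_div_eval_laguerreNegPoly_le (n : ℕ) {r : ℝ} (hr : 0 ≤ r) :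
    r ^ n / (laguerreNegPoly n).eval r ≤ n.factorial := by
  have h := coeff_mul_pow_le_eval_laguerreNegPoly n le_rfl hr
  rw [Nat.choose_self, Nat.cast_one, one_div_mul_eq_div, div_le_iff₀ (by positivity)] at h
  rw [div_le_iff₀ (one_pos.trans_le (one_le_eval_laguerreNegPoly n r hr))]
  linarith

theorem natDegree_laguerreNegPoly (n : ℕ) : (laguerreNegPoly n).natDegree = n := by
  refine natDegree_eq_of_le_of_coeff_ne_zero (natDegree_le_iff_coeff_eq_zero.2 fun k hk => ?_) ?_
  · rw [coeff_laguerreNegPoly, Nat.choose_eq_zero_of_lt hk, Nat.cast_zero, zero_div]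
  · rw [coeff_laguerreNegPoly, Nat.choose_self]
    positivity

theorem tendsto_pow_div_eval_laguerreNegPoly (n : ℕ) :
    Tendsto (fun r => r ^ n / (laguerreNegPoly n).eval r) atTop (𝓝 n.factorial) := by
  have hdeg : (X ^ n : ℝ[X]).degree = (laguerreNegPoly n).degree := by
    have h0 : laguerreNegPoly n ≠ 0 := fun h => by
      have := one_le_eval_laguerreNegPoly n 0 le_rfl
      norm_num [h] at this
    rw [degree_X_pow, degree_eq_natDegree h0, natDegree_laguerreNegPoly]
  simpa [leadingCoeff, natDegree_laguerreNegPoly, coeff_laguerreNegPoly] using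
    div_tendsto_atTop_leadingCoeff_div_of_degree_eq _ _ hdeg

theorem laguerreIntegrand_eq_gammaPDFReal_mul (n : ℕ) {s r : ℝ} (hs : 0 < s) (hr : 0 < r) :
    laguerreIntegrand n (s + n - 1) r =
      Real.Gamma s * (gammaPDFReal s 1 r * ((laguerreNegPoly n).eval r)⁻¹) := by
  have := Real.Gamma_pos_of_pos hs
  rw [laguerreIntegrand, gammaPDFReal, if_pos hr.le, Real.one_rpow, one_mul,
    eval_laguerreNegPoly, show s + n - 1 - n = s - 1 by ring]
  field_simp

theorem integrable_inv_eval_laguerreNegPoly (n : ℕ) {s : ℝ} (hs : 0 < s) :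
    Integrable (fun r => ((laguerreNegPoly n).eval r)⁻¹) (gammaMeasure s 1) := by
  simpa using integrable_eval_div_eval_pow_gammaMeasure hs one_pos one_pos
    (one_le_eval_laguerreNegPoly n) 1 1

theorem integrableOn_laguerreIntegrand (n : ℕ) {p : ℝ} (hp : (n : ℝ) - 1 < p) :
    IntegrableOn (laguerreIntegrand n p) (Set.Ioi 0) := by
  obtain ⟨s, rfl⟩ : ∃ s, p = s + n - 1 := ⟨p - n + 1, by ring⟩
  have hs : 0 < s := by linarith
  refine (integrableOn_congr_fun (fun r hr => laguerreIntegrand_eq_gammaPDFReal_mul n hs hr)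
    measurableSet_Ioi).2 (((integrable_gammaMeasure_iff hs one_pos).1
      (integrable_inv_eval_laguerreNegPoly n hs)).const_mul _)

theorem laguerreA_eq_integral_inv_gammaMeasure (n : ℕ) {s : ℝ} (hs : 0 < s) :
    laguerreA n (s + n - 1) = Real.Gamma (s + n) / (n.factorial * Real.Gamma s) *
      ∫ r, ((laguerreNegPoly n).eval r)⁻¹ ∂gammaMeasure s 1 := by
  have := Real.Gamma_pos_of_pos hs
  rw [laguerreA, integral_gammaMeasure hs one_pos, add_sub_cancel, add_sub_cancel_right,
    setIntegral_congr_fun measurableSet_Ioi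
      fun r hr => laguerreIntegrand_eq_gammaPDFReal_mul n hs hr,
    integral_const_mul]
  field_simp

theorem laguerreA_eq_integral_gammaMeasure (n : ℕ) {s : ℝ} (hs : 0 < s) :
    laguerreA n (s + n - 1) = (∫ r, r ^ n * ((oneSubDerivNumerator (laguerreNegPoly n) n).eval r /
      (laguerreNegPoly n).eval r ^ (n + 1)) ∂gammaMeasure s 1) / n.factorial := by
  rw [laguerreA_eq_integral_inv_gammaMeasure n hs,
    integral_inv_eval_gammaMeasure hs one_pos (one_le_eval_laguerreNegPoly n) n,
    integral_pow_mul_gammaMeasure hs one_pos, one_pow, mul_one]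
  ring

theorem pow_mul_eval_oneSubDerivNumerator_lt {n : ℕ} (h₁ : 1 ≤ n) (h₄ : n ≤ 4) {r : ℝ}
    (hr : 0 < r) : r ^ n * (oneSubDerivNumerator (laguerreNegPoly n) n).eval r <
      n.factorial * (laguerreNegPoly n).eval r ^ (n + 1) := by
  -- As a polynomial in `r`, the difference of the two sides has nonnegative coefficients.
  interval_cases n <;>
  · simp only [oneSubDerivNumerator, laguerreNegPoly, Finset.sum_range_succ, Finset.sum_range_zero,
      Nat.choose, Nat.factorial, derivative_add, derivative_sub, derivative_mul, derivative_C,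
      derivative_X_pow, derivative_natCast, derivative_zero, derivative_one, eval_add, eval_sub,
      eval_mul, eval_pow, eval_C, eval_X, eval_natCast, eval_zero, eval_one]
    rw [← sub_pos]
    ring_nf
    positivity

theorem laguerreA_lt_one {n : ℕ} (h₁ : 1 ≤ n) (h₄ : n ≤ 4) {p : ℝ} (hp : (n : ℝ) - 1 < p) :
    laguerreA n p < 1 := by
  obtain ⟨s, rfl⟩ : ∃ s, p = s + n - 1 := ⟨p - n + 1, by ring⟩
  have hs : 0 < s := by linarith
  have := isProbabilityMeasure_gammaMeasure hs one_pos
  have hint := (integrable_pow_mul_gammaMeasure_iff hs one_pos n).2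
    (integrable_eval_div_eval_pow_gammaMeasure (by positivity) one_pos one_pos
      (one_le_eval_laguerreNegPoly n) (oneSubDerivNumerator (laguerreNegPoly n) n) (n + 1))
  obtain ⟨r, hr, hle⟩ := exists_notMem_null_integral_le hint (ae_iff.1 (ae_pos_gammaMeasure s 1))
  have hr : 0 < r := not_not.1 hr
  rw [laguerreA_eq_integral_gammaMeasure n hs, div_lt_one (by positivity)]
  refine hle.trans_lt ?_
  have hL := one_pos.trans_le (one_le_eval_laguerreNegPoly n r hr.le)
  rw [← mul_div_assoc, div_lt_iff₀ (by positivity)]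
  exact pow_mul_eval_oneSubDerivNumerator_lt h₁ h₄ hr

theorem laguerreA_zero {p : ℝ} (hp : -1 < p) : laguerreA 0 p = 1 := by
  have hs : 0 < p + 1 := by linarith
  have := isProbabilityMeasure_gammaMeasure hs one_pos
  simpa [oneSubDerivNumerator, laguerreNegPoly] using laguerreA_eq_integral_gammaMeasure 0 hs

theorem tendsto_Gamma_add_nat_div_Gamma_mul_pow (j : ℕ) :
    Tendsto (fun x => Real.Gamma (x + j) / (Real.Gamma x * x ^ j)) atTop (𝓝 1) := by
  induction j with
  | zero =>
    refine tendsto_const_nhds.congr' ?_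
    filter_upwards [eventually_gt_atTop 0] with x hx
    simp [(Real.Gamma_pos_of_pos hx).ne']
  | succ j ih =>
    have hone : Tendsto (fun x : ℝ => 1 + j / x) atTop (𝓝 1) := by
      simpa using (tendsto_const_nhds.div_atTop tendsto_id).const_add (1 : ℝ)
    rw [← one_mul (1 : ℝ)]
    refine (ih.mul hone).congr' ?_
    filter_upwards [eventually_gt_atTop 0] with x hx
    have := Real.Gamma_pos_of_pos hx
    rw [Nat.cast_succ, ← add_assoc, Real.Gamma_add_one (by positivity), pow_succ]
    field_simp

theorem tendsto_Gamma_mul_Gamma_div_Gamma_sq (n : ℕ) :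
    Tendsto (fun x => Real.Gamma (x + (2 * n : ℕ)) * Real.Gamma x / Real.Gamma (x + n) ^ 2) atTop
      (𝓝 1) := by
  have h := (tendsto_Gamma_add_nat_div_Gamma_mul_pow (2 * n)).div
    ((tendsto_Gamma_add_nat_div_Gamma_mul_pow n).pow 2) (by norm_num)
  rw [one_pow, div_one] at h
  refine h.congr' ?_
  filter_upwards [eventually_gt_atTop 0] with x hx
  have := Real.Gamma_pos_of_pos hx
  have : 0 < Real.Gamma (x + n) := Real.Gamma_pos_of_pos (by positivity)
  simp only [Pi.div_apply, pow_mul']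
  field_simp

theorem tendsto_integral_pow_div_gammaMeasure (n : ℕ) :
    Tendsto (fun a => ∫ r, r ^ n * ((laguerreNegPoly n).eval r)⁻¹ ∂gammaMeasure a 1) atTop
      (𝓝 n.factorial) := by
  simp only [← div_eq_mul_inv]
  refine tendsto_integral_gammaMeasure (M := n.factorial) one_pos
    ((measurable_id.pow_const n).div (laguerreNegPoly n).continuous.measurable)
    (fun r hr => ?_) (tendsto_pow_div_eval_laguerreNegPoly n)
  have hL := one_pos.trans_le (one_le_eval_laguerreNegPoly n r hr.le)
  exact (abs_of_nonneg (by positivity)).trans_le (pow_div_eval_laguerreNegPoly_le n hr.le)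

theorem tendsto_laguerreA (n : ℕ) : Tendsto (laguerreA n) atTop (𝓝 1) := by
  have hlim := ((tendsto_Gamma_mul_Gamma_div_Gamma_sq n).mul
    (tendsto_integral_pow_div_gammaMeasure n)).div_const (n.factorial : ℝ)
  rw [one_mul, div_self (by positivity)] at hlim
  refine (hlim.comp (tendsto_atTop_add_const_right _ (1 - 2 * (n : ℝ)) tendsto_id)).congr' ?_
  filter_upwards [eventually_gt_atTop (2 * n - 1 : ℝ)] with p hp
  obtain ⟨x, rfl⟩ : ∃ x, p = x + n + n - 1 := ⟨p - n - n + 1, by ring⟩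
  have hx : 0 < x := by linarith
  have := Real.Gamma_pos_of_pos hx
  have : 0 < Real.Gamma (x + n) := Real.Gamma_pos_of_pos (by positivity)
  rw [laguerreA_eq_integral_inv_gammaMeasure n (by positivity), Function.comp_apply, id,
    show x + n + n - 1 + (1 - 2 * n) = x by ring, Nat.cast_mul, Nat.cast_two, two_mul,
    ← add_assoc, integral_pow_mul_gammaMeasure hx one_pos, one_pow]
  field_simp

end Laguerre

section FockSpace

open Real ProbabilityTheory

theorem tsum_enorm_sq_of_hasSum_smul_orthonormal {𝕜 E ι : Type*} [RCLike 𝕜]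
    [NormedAddCommGroup E] [InnerProductSpace 𝕜 E] {v : ι → E} (hv : Orthonormal 𝕜 v)
    {c : ι → 𝕜} {x : E} (h : HasSum (fun i => c i • v i) x) : ∑' i, ‖c i‖ₑ ^ 2 = ‖x‖ₑ ^ 2 := by
  have hfin (s : Finset ι) : ‖∑ i ∈ s, c i • v i‖ ^ 2 = ∑ i ∈ s, ‖c i‖ ^ 2 := by
    rw [← RCLike.ofReal_inj (K := 𝕜), RCLike.ofReal_pow, ← inner_self_eq_norm_sq_to_K (𝕜 := 𝕜),
      hv.inner_sum]
    simp [RCLike.conj_mul]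
  have hlim : HasSum (fun i => ‖c i‖ₑ ^ 2) (‖x‖ₑ ^ 2) := by
    refine (((ENNReal.continuous_pow 2).comp continuous_enorm).tendsto x |>.comp h).congr
      fun s => ?_
    simp only [Function.comp_apply, ← ofReal_norm, ← ENNReal.ofReal_pow (norm_nonneg _)]
    rw [hfin, ENNReal.ofReal_sum_of_nonneg fun _ _ => by positivity]
  exact hlim.tsum_eq

theorem lintegral_enorm_sq_haarAddCircle {T : ℝ} [Fact (0 < T)] {ι : Type*} {m : ι → ℤ}
    (hm : Function.Injective m) {c : ι → ℂ} {F : C(AddCircle T, ℂ)}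
    (hF : HasSum (fun i => c i • fourier (m i)) F) :
    ∫⁻ t, ‖F t‖ₑ ^ 2 ∂AddCircle.haarAddCircle = ∑' i, ‖c i‖ₑ ^ 2 := by
  have hLp : HasSum (fun i => c i • fourierLp 2 (m i))
      (ContinuousMap.toLp (E := ℂ) 2 AddCircle.haarAddCircle ℂ F) := by
    simpa using hF.mapL (ContinuousMap.toLp (E := ℂ) 2 AddCircle.haarAddCircle ℂ)
  rw [tsum_enorm_sq_of_hasSum_smul_orthonormal (orthonormal_fourier.comp _ hm) hLp, Lp.enorm_def,
    eLpNorm_congr_ae (ContinuousMap.coeFn_toLp _ F)]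
  simpa using (eLpNorm_nnreal_pow_eq_lintegral (p := 2) (f := F) two_ne_zero).symm

theorem lintegral_enorm_sq_of_hasSum_exp {c : ℕ → ℂ} {h : ℝ → ℂ}
    (hh : ∀ θ : ℝ, HasSum (fun k : ℕ => c k * Complex.exp (k * (θ * Complex.I))) (h θ)) :
    ∫⁻ θ in Set.Ioo (-π) π, ‖h θ‖ₑ ^ 2 = ENNReal.ofReal (2 * π) * ∑' k, ‖c k‖ₑ ^ 2 := by
  have : Fact (0 < 2 * π) := ⟨two_pi_pos⟩
  have hc : Summable fun k => ‖c k‖ := by simpa using (hh 0).summable.norm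
  obtain ⟨F, hF⟩ : Summable fun k : ℕ => c k • @fourier (2 * π) k :=
    .of_norm (by simpa [norm_smul, fourier_norm] using hc)
  have hFh (θ : ℝ) : F θ = h θ := by
    refine (ContinuousMap.hasSum_apply hF θ).unique ((hh θ).congr_fun fun k => ?_)
    have hπ : (π : ℂ) ≠ 0 := Complex.ofReal_ne_zero.2 pi_ne_zero
    rw [ContinuousMap.smul_apply, fourier_coe_apply, smul_eq_mul]
    congr 2
    push_cast
    field_simp
  rw [← lintegral_enorm_sq_haarAddCircle Nat.cast_injective hF, ← smul_eq_mul,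
    ← lintegral_smul_measure, ← AddCircle.volume_eq_smul_haarAddCircle,
    ← AddCircle.lintegral_preimage (2 * π) (-π), show -π + 2 * π = π by ring]
  simp only [hFh]
  exact setLIntegral_congr Ioo_ae_eq_Ioc

section SquareIntegrable

variable {X Y E F : Type*} [MeasurableSpace X] [MeasurableSpace Y] [NormedAddCommGroup E]
  [NormedAddCommGroup F] {μ : Measure X} {ν : Measure Y} {f : X → E} {g : Y → F}

theorem memLp_two_iff_lintegral_enorm_sq_lt_top (hf : AEStronglyMeasurable f μ) :
    MemLp f 2 μ ↔ ∫⁻ x, ‖f x‖ₑ ^ 2 ∂μ < ⊤ := by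
  have h := eLpNorm_lt_top_iff_lintegral_rpow_enorm_lt_top (f := f) (μ := μ) two_ne_zero
    ENNReal.ofNat_ne_top
  simp only [ENNReal.toReal_ofNat, ENNReal.rpow_ofNat] at h
  rw [MemLp, h, and_iff_right hf]

theorem integral_norm_sq_eq_toReal_lintegral (hf : AEStronglyMeasurable f μ) :
    ∫ x, ‖f x‖ ^ 2 ∂μ = (∫⁻ x, ‖f x‖ₑ ^ 2 ∂μ).toReal := by
  rw [integral_eq_lintegral_of_nonneg_ae (.of_forall fun x => sq_nonneg _) (hf.norm.pow 2)]
  simp only [ENNReal.ofReal_pow (norm_nonneg _), ofReal_norm]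

theorem memLp_two_and_integral_norm_sq_le (hf : MemLp f 2 μ) (hg : AEStronglyMeasurable g ν)
    (h : ∫⁻ y, ‖g y‖ₑ ^ 2 ∂ν ≤ ∫⁻ x, ‖f x‖ₑ ^ 2 ∂μ) :
    MemLp g 2 ν ∧ ∫ y, ‖g y‖ ^ 2 ∂ν ≤ ∫ x, ‖f x‖ ^ 2 ∂μ := by
  have hfin := (memLp_two_iff_lintegral_enorm_sq_lt_top hf.1).1 hf
  rw [memLp_two_iff_lintegral_enorm_sq_lt_top hg, integral_norm_sq_eq_toReal_lintegral hg,
    integral_norm_sq_eq_toReal_lintegral hf.1]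
  exact ⟨h.trans_lt hfin, ENNReal.toReal_mono hfin.ne h⟩

end SquareIntegrable

/-- The `k`-th coefficient of the Taylor expansion of `f` at the origin. -/
noncomputable def taylorCoeff (f : ℂ → ℂ) (k : ℕ) : ℂ :=
  iteratedDeriv k f 0 / k.factorial

variable {f : ℂ → ℂ}

theorem taylorCoeff_iteratedDeriv (f : ℂ → ℂ) (n k : ℕ) :
    taylorCoeff (iteratedDeriv n f) k =
      ((k + n).factorial / k.factorial : ℝ) * taylorCoeff f (k + n) := by
  have hk : ((k + n).factorial : ℂ) ≠ 0 := Nat.cast_ne_zero.2 (Nat.factorial_ne_zero _)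
  simp only [taylorCoeff, iteratedDeriv_eq_iterate, Function.iterate_add_apply]
  push_cast
  field_simp

theorem enorm_sq_taylorCoeff_iteratedDeriv (f : ℂ → ℂ) (n k : ℕ) :
    ‖taylorCoeff (iteratedDeriv n f) k‖ₑ ^ 2 =
      ENNReal.ofReal (((k + n).factorial / k.factorial) ^ 2) * ‖taylorCoeff f (k + n)‖ₑ ^ 2 := by
  rw [taylorCoeff_iteratedDeriv, enorm_mul, mul_pow, ← ofReal_norm (Complex.ofReal _),
    Complex.norm_real, norm_of_nonneg (by positivity), ENNReal.ofReal_pow (by positivity)]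

theorem hasSum_taylorCoeff_mul_pow (hf : Differentiable ℂ f) (z : ℂ) :
    HasSum (fun k => taylorCoeff f k * z ^ k) (f z) := by
  refine (Complex.hasSum_taylorSeries_of_entire hf 0 z).congr_fun fun k => ?_
  rw [taylorCoeff, sub_zero, smul_eq_mul, smul_eq_mul]
  ring

theorem lintegral_enorm_sq_polarCoord_symm (hf : Differentiable ℂ f) (ρ : ℝ) :
    ∫⁻ θ in Set.Ioo (-π) π, ‖f (Complex.polarCoord.symm (ρ, θ))‖ₑ ^ 2 =
      ENNReal.ofReal (2 * π) * ∑' k, ‖taylorCoeff f k * (ρ : ℂ) ^ k‖ₑ ^ 2 := by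
  refine lintegral_enorm_sq_of_hasSum_exp fun θ =>
    (hasSum_taylorCoeff_mul_pow hf _).congr_fun fun k => ?_
  rw [Complex.polarCoord_symm_apply, Complex.ofReal_cos, Complex.ofReal_sin, ← Complex.exp_mul_I,
    mul_pow, ← Complex.exp_nat_mul, mul_assoc]

theorem lintegral_enorm_sq_mul_radial (hf : Differentiable ℂ f) {W : ℝ → ENNReal}
    (hW : Measurable W) :
    ∫⁻ z, ‖f z‖ₑ ^ 2 * W ‖z‖ =
      ∑' k, ‖taylorCoeff f k‖ₑ ^ 2 *
        ∫⁻ ρ in Set.Ioi 0, ENNReal.ofReal (2 * π * ρ ^ (2 * k + 1)) * W ρ := by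
  have hfm : Measurable f := hf.continuous.measurable
  have hpolar : Measurable (Complex.polarCoord.symm : ℝ × ℝ → ℂ) := by
    simp only [funext Complex.polarCoord_symm_apply]
    fun_prop
  have hangle : ∀ ρ ∈ Set.Ioi (0 : ℝ), ∫⁻ θ in Set.Ioo (-π) π, ENNReal.ofReal ρ •
      (‖f (Complex.polarCoord.symm (ρ, θ))‖ₑ ^ 2 * W ‖Complex.polarCoord.symm (ρ, θ)‖) =
      ∑' k, ‖taylorCoeff f k‖ₑ ^ 2 *
        (ENNReal.ofReal (2 * π * ρ ^ (2 * k + 1)) * W ρ) := by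
    intro ρ hρ
    have hρ : 0 < ρ := hρ
    simp only [Complex.norm_polarCoord_symm, abs_of_pos hρ, smul_eq_mul]
    rw [lintegral_const_mul _ (by fun_prop), lintegral_mul_const _ (by fun_prop),
      lintegral_enorm_sq_polarCoord_symm hf, ← ENNReal.tsum_mul_left, ← ENNReal.tsum_mul_right,
      ← ENNReal.tsum_mul_left]
    refine tsum_congr fun k => ?_
    have hρk : ‖(ρ : ℂ) ^ k‖ₑ = ENNReal.ofReal (ρ ^ k) := by
      rw [← ofReal_norm, norm_pow, Complex.norm_real, norm_of_nonneg hρ.le]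
    have hsplit : ENNReal.ofReal (2 * π * ρ ^ (2 * k + 1)) =
        ENNReal.ofReal (2 * π) * ENNReal.ofReal (ρ ^ k) ^ 2 * ENNReal.ofReal ρ := by
      rw [← ENNReal.ofReal_pow (by positivity), ← ENNReal.ofReal_mul (by positivity),
        ← ENNReal.ofReal_mul (by positivity), pow_succ, pow_mul', ← mul_assoc]
    rw [enorm_mul, hρk, hsplit]
    ring
  rw [← Complex.lintegral_comp_polarCoord_symm, polarCoord_target, Measure.volume_eq_prod,
    ← Measure.prod_restrict, lintegral_prod _ (by fun_prop),
    setLIntegral_congr_fun measurableSet_Ioi hangle, lintegral_tsum fun k => by fun_prop]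
  exact tsum_congr fun k => lintegral_const_mul _ (by fun_prop)

theorem lintegral_comp_const_mul_sq {α : ℝ} (hα : 0 < α) (u : ℝ → ENNReal) :
    ∫⁻ r in Set.Ioi 0, u r =
      ∫⁻ ρ in Set.Ioi 0, ENNReal.ofReal (2 * α * ρ) * u (α * ρ ^ 2) := by
  have himage : (fun ρ : ℝ => α * ρ ^ 2) '' Set.Ioi 0 = Set.Ioi 0 := by
    refine Set.Subset.antisymm ?_ fun r hr => ⟨√(r / α), ?_, ?_⟩
    · rintro _ ⟨ρ, hρ, rfl⟩
      exact mul_pos hα (pow_pos hρ 2)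
    · exact sqrt_pos.2 (div_pos hr hα)
    · simp only [sq_sqrt (div_pos (Set.mem_Ioi.1 hr) hα).le]
      field_simp
  have hderiv (ρ : ℝ) : HasDerivAt (fun ρ : ℝ => α * ρ ^ 2) (2 * α * ρ) ρ :=
    ((hasDerivAt_pow 2 ρ).const_mul α).congr_deriv (by push_cast; ring)
  have hmono : MonotoneOn (fun ρ : ℝ => α * ρ ^ 2) (Set.Ioi 0) := fun x hx y _ hxy => by
    have hx : 0 < x := hx
    simp only
    gcongr
  conv_lhs => rw [← himage]
  exact lintegral_image_eq_lintegral_deriv_mul_of_monotoneOn measurableSet_Ioi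
    (fun ρ _ => (hderiv ρ).hasDerivWithinAt) hmono u

variable {α : ℝ}

theorem lintegral_enorm_sq_mul_fockMeasure (hα : 0 < α) (hf : Differentiable ℂ f)
    {V : ℝ → ENNReal} (hV : Measurable V) :
    ∫⁻ z, ‖f z‖ₑ ^ 2 * V (α * ‖z‖ ^ 2) ∂fockMeasure α =
      ∑' k : ℕ, ‖taylorCoeff f k‖ₑ ^ 2 *
        (ENNReal.ofReal (k.factorial / α ^ k) * ∫⁻ r, V r ∂gammaMeasure (k + 1) 1) := by
  have hfm : Measurable f := hf.continuous.measurable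
  have hradial := lintegral_enorm_sq_mul_radial hf
    (W := fun ρ => ENNReal.ofReal (α / π * exp (-α * ρ ^ 2)) * V (α * ρ ^ 2)) (by fun_prop)
  rw [fockMeasure, lintegral_withDensity_eq_lintegral_mul _ (by fun_prop) (by fun_prop)]
  simp only [Pi.mul_apply, mul_left_comm (ENNReal.ofReal _) (‖f _‖ₑ ^ 2)]
  rw [hradial]
  refine tsum_congr fun k => ?_
  congr 1
  rw [lintegral_gammaMeasure _ _ hV, ← lintegral_const_mul' _ _ ENNReal.ofReal_ne_top]
  conv_rhs => rw [lintegral_comp_const_mul_sq hα]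
  refine setLIntegral_congr_fun measurableSet_Ioi fun ρ hρ => ?_
  have hρ : 0 < ρ := hρ
  simp only [← mul_assoc]
  rw [gammaPDF_of_nonneg (by positivity), ← ENNReal.ofReal_mul (by positivity),
    ← ENNReal.ofReal_mul (by positivity), ← ENNReal.ofReal_mul (by positivity),
    Gamma_nat_eq_factorial, add_sub_cancel_right, rpow_natCast, one_rpow]
  congr 2
  field_simp
  ring

theorem lintegral_enorm_sq_fockMeasure (hα : 0 < α) (hf : Differentiable ℂ f) :
    ∫⁻ z, ‖f z‖ₑ ^ 2 ∂fockMeasure α =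
      ∑' k : ℕ, ‖taylorCoeff f k‖ₑ ^ 2 * ENNReal.ofReal (k.factorial / α ^ k) := by
  have h := lintegral_enorm_sq_mul_fockMeasure hα hf (V := fun _ => 1) measurable_const
  simp only [mul_one, lintegral_const, one_mul] at h
  rw [h]
  refine tsum_congr fun k => ?_
  have := isProbabilityMeasure_gammaMeasure (a := k + 1) (by positivity) one_pos
  rw [measure_univ, mul_one]

theorem ofReal_laguerreA_add_nat (n k : ℕ) :
    ENNReal.ofReal (laguerreA n (k + n : ℕ)) =
      ENNReal.ofReal ((k + n).factorial / (n.factorial * k.factorial)) *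
        ∫⁻ r, ENNReal.ofReal ((laguerreNegPoly n).eval r)⁻¹ ∂gammaMeasure (k + 1) 1 := by
  have hk : (0 : ℝ) < k + 1 := by positivity
  have hpos : 0 ≤ᵐ[gammaMeasure (k + 1) 1] fun r => ((laguerreNegPoly n).eval r)⁻¹ := by
    filter_upwards [ae_pos_gammaMeasure (k + 1) 1] with r hr
    exact inv_nonneg.2 (zero_le_one.trans (one_le_eval_laguerreNegPoly n r hr.le))
  rw [← ofReal_integral_eq_lintegral_ofReal (integrable_inv_eval_laguerreNegPoly n hk) hpos,
    ← ENNReal.ofReal_mul (by positivity),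
    show ((k + n : ℕ) : ℝ) = (k + 1 : ℝ) + n - 1 by push_cast; ring,
    laguerreA_eq_integral_inv_gammaMeasure n hk, Gamma_nat_eq_factorial,
    show (k + 1 : ℝ) + n = (k + n : ℕ) + 1 by push_cast; ring, Gamma_nat_eq_factorial]

theorem lintegral_enorm_sq_iteratedDeriv_fockMeasureN (n : ℕ) (hα : 0 < α)
    (hf : Differentiable ℂ f) :
    ∫⁻ z, ‖iteratedDeriv n f z‖ₑ ^ 2 ∂fockMeasureN n α =
      ∑' k : ℕ, ‖taylorCoeff f (k + n)‖ₑ ^ 2 *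
        ENNReal.ofReal ((k + n).factorial / α ^ (k + n)) *
          ENNReal.ofReal (laguerreA n (k + n : ℕ)) := by
  have hg : Differentiable ℂ (iteratedDeriv n f) :=
    (hf.contDiff (n := (n + 1 : ℕ))).differentiable_iteratedDeriv n
      (by exact_mod_cast n.lt_succ_self)
  have hgm : Measurable (iteratedDeriv n f) := hg.continuous.measurable
  have hLm : Measurable fun r => (laguerreNegPoly n).eval r :=
    (laguerreNegPoly n).continuous.measurable
  have hweight (x : ℝ) : ENNReal.ofReal (1 / (n.factorial * α ^ n * laguerre n (-α * x))) =
      ENNReal.ofReal (n.factorial * α ^ n)⁻¹ *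
        ENNReal.ofReal ((laguerreNegPoly n).eval (α * x))⁻¹ := by
    rw [eval_laguerreNegPoly, ← ENNReal.ofReal_mul (by positivity), ← mul_inv, one_div, neg_mul]
  simp only [fockMeasureN, hweight]
  rw [lintegral_withDensity_eq_lintegral_mul _ (by fun_prop) (by fun_prop)]
  simp only [Pi.mul_apply, mul_comm _ (‖iteratedDeriv n f _‖ₑ ^ 2)]
  rw [lintegral_enorm_sq_mul_fockMeasure hα hg (V := fun r => ENNReal.ofReal _ *
    ENNReal.ofReal ((laguerreNegPoly n).eval r)⁻¹) (by fun_prop)]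
  refine tsum_congr fun k => ?_
  have hconst : ENNReal.ofReal (((k + n).factorial / k.factorial : ℝ) ^ 2) *
      ENNReal.ofReal (k.factorial / α ^ k) * ENNReal.ofReal (n.factorial * α ^ n)⁻¹ =
      ENNReal.ofReal ((k + n).factorial / α ^ (k + n)) *
        ENNReal.ofReal ((k + n).factorial / (n.factorial * k.factorial)) := by
    rw [← ENNReal.ofReal_mul (by positivity), ← ENNReal.ofReal_mul (by positivity),
      ← ENNReal.ofReal_mul (by positivity)]
    congr 1
    field_simp
    ring
  rw [lintegral_const_mul _ (by fun_prop), ofReal_laguerreA_add_nat,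
    enorm_sq_taylorCoeff_iteratedDeriv, mul_assoc (_ ^ 2),
    ← mul_assoc (ENNReal.ofReal ((k + n).factorial / α ^ (k + n))), ← hconst]
  ring

theorem lintegral_enorm_sq_iteratedDeriv_le {n : ℕ} (hA : ∀ k : ℕ, laguerreA n (k + n : ℕ) ≤ 1)
    (hα : 0 < α) (hf : Differentiable ℂ f) :
    ∫⁻ z, ‖iteratedDeriv n f z‖ₑ ^ 2 ∂fockMeasureN n α ≤ ∫⁻ z, ‖f z‖ₑ ^ 2 ∂fockMeasure α := by
  rw [lintegral_enorm_sq_iteratedDeriv_fockMeasureN n hα hf, lintegral_enorm_sq_fockMeasure hα hf]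
  exact (ENNReal.tsum_le_tsum fun k => mul_le_of_le_one_right'
    (ENNReal.ofReal_le_one.2 (hA k))).trans
      (ENNReal.tsum_comp_le_tsum_of_injective (add_left_injective n) _)

end FockSpace

theorem mainTheorem4_general (n : ℕ) :
    (∀ p : ℝ, (n : ℝ) - 1 < p → IntegrableOn (laguerreIntegrand n p) (Set.Ioi 0)) ∧
    Filter.Tendsto (laguerreA n) Filter.atTop (nhds 1) ∧
    (n = 0 → ∀ p : ℝ, -1 < p → laguerreA n p = 1) ∧
    (1 ≤ n → n ≤ 4 → ∀ p : ℝ, (n : ℝ) - 1 < p → laguerreA n p < 1) ∧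
    (n ≤ 4 → ∀ α : ℝ, 0 < α → ∀ f : ℂ → ℂ, MemFock α f →
      MemLp (iteratedDeriv n f) 2 (fockMeasureN n α) ∧
      ∫ z, ‖iteratedDeriv n f z‖ ^ 2 ∂(fockMeasureN n α) ≤ ∫ z, ‖f z‖ ^ 2 ∂(fockMeasure α)) := by
  have hzero : n = 0 → ∀ p : ℝ, -1 < p → laguerreA n p = 1 := by
    rintro rfl p hp
    exact laguerreA_zero hp
  refine ⟨fun p hp => integrableOn_laguerreIntegrand n hp, tendsto_laguerreA n, hzero,
    fun h₁ h₄ p hp => laguerreA_lt_one h₁ h₄ hp, fun h₄ α hα f ⟨hf, hfL⟩ => ?_⟩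
  have hA (k : ℕ) : laguerreA n (k + n : ℕ) ≤ 1 := by
    have : (0 : ℝ) ≤ k := k.cast_nonneg
    rcases n.eq_zero_or_pos with h₀ | h₁
    · exact (hzero h₀ _ (by push_cast; linarith)).le
    · exact (laguerreA_lt_one h₁ h₄ (by push_cast; linarith)).le
  have hderiv : Continuous (iteratedDeriv n f) :=
    (hf.contDiff (n := (n : ℕ))).continuous_iteratedDeriv n le_rfl
  exact memLp_two_and_integral_norm_sq_le hfL hderiv.aestronglyMeasurable
    (lintegral_enorm_sq_iteratedDeriv_le hA hα hf)

theorem mainTheorem4 (n : ℕ) :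
    (∀ p : ℝ, (n : ℝ) ≤ p →
      MeasureTheory.IntegrableOn (laguerreIntegrand n p) (Set.Ioi (0 : ℝ))) ∧
    Filter.Tendsto (laguerreA n) Filter.atTop (nhds 1) ∧
    (n = 0 → ∀ p : ℝ, 0 ≤ p → laguerreA n p = 1) ∧
    (1 ≤ n → n ≤ 4 → ∀ p : ℝ, (n : ℝ) ≤ p → laguerreA n p < 1) ∧
    (n ≤ 4 → ∀ α : ℝ, 0 < α → ∀ f : ℂ → ℂ, MemFock α f →
      MeasureTheory.MemLp (iteratedDeriv n f) 2 (fockMeasureN n α) ∧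
      ∫ z, ‖iteratedDeriv n f z‖ ^ 2 ∂(fockMeasureN n α) ≤ ∫ z, ‖f z‖ ^ 2 ∂(fockMeasure α)) := by
  obtain ⟨hint, hlim, hzero, hlt, hfock⟩ := mainTheorem4_general n
  exact ⟨fun p hp => hint p (by linarith), hlim, fun hn p hp => hzero hn p (by linarith),
    fun h₁ h₄ p hp => hlt h₁ h₄ p (by linarith), hfock⟩
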